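/- Let $m\ge 1$, $n_1,n_2,k_1,k_2\ge 0$ be integers and let $r_1,r_2>0$ be real numbers with $r_1^2+r_2^2=1$. For $i=1,2$ let $F_i:\mathbb{R}^{m+1}\to\mathbb{R}^{n_i+1}$ be a harmonic form of degree $k_i$, i.e. each component of $F_i$ is a homogeneous polynomial of degree $k_i$ (possibly zero) and the Euclidean Laplacian of $F_i$ vanishes. Suppose that $F_i$ maps the unit sphere $\mathbb{S}^m$ into the sphere $\mathbb{S}^{n_i}(r_i)\subset\mathbb{R}^{n_i+1}$ of radius $r_i$ centred at the origin; let $\varphi_i:\mathbb{S}^m\to\mathbb{S}^{n_i}(r_i)$ be the restriction and $\Phi_i:\mathbb{S}^m\to\mathbb{R}^{n_i+1}$ the same map regarded as vector valued. Let $$\varphi=\iota\circ(\varphi_1,\varphi_2):\mathbb{S}^m\to\mathbb{S}^{n_1+n_2+1},$$ where $\iota:\mathbb{S}^{n_1}(r_1)\times\mathbb{S}^{n_2}(r_2)\to\mathbb{S}^{n_1+n_2+1}\subset\mathbb{R}^{n_1+1}\times\mathbb{R}^{n_2+1}$ is the canonical inclusion. Write $\tau(\varphi)=\operatorname{trace}\nabla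 d\varphi$ for the tension field and $$\tau_2(\varphi)=-\Delta\tau(\varphi)-\operatorname{trace}R\big(d\varphi(\cdot),\tau(\varphi)\big)d\varphi(\cdot)$$ for the bitension field, where $\Delta=-\operatorname{trace}\nabla^2$ is the rough Laplacian on sections of $\varphi^{-1}T\mathbb{S}^{n_1+n_2+1}$ and $R(X,Y)Z=\nabla_X\nabla_YZ-\nabla_Y\nabla_XZ-\nabla_{[X,Y]}Z$ is the curvature tensor of the target sphere; $\varphi$ is called harmonic if $\tau(\varphi)=0$, biharmonic if $\tau_2(\varphi)=0$, and proper biharmonic if it is biharmonic but not harmonic. Then $\varphi$ is proper biharmonic if and only if $r_1=r_2=1/\sqrt2$ and $k_1\ne k_2$. Moreover, on $\mathbb{S}^m$, $$\tau_2(\varphi)=(2r_1^2-1)(k_1-k_2)^2(m+k_1+k_2-1)^2\big((r_1^2-1)\Phi_1,\;r_1^2\Phi_2\big).$$ -/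

import Mathlib

open scoped Manifold ContDiff

noncomputable section

namespace SphereMaps

open Module

/-- Euclidean space `ℝ^(n+1)`. -/
abbrev Euc (n : ℕ) : Type := EuclideanSpace ℝ (Fin (n + 1))

/-- The sphere of radius `r` centred at the origin of a Euclidean space `E`. -/
abbrev Sph (E : Type*) [NormedAddCommGroup E] (r : ℝ) : Type _ := Metric.sphere (0 : E) r

section Geometry

variable {E : Type*} [NormedAddCommGroup E] [InnerProductSpace ℝ E]
variable {F : Type*} [NormedAddCommGroup F] [InnerProductSpace ℝ F]

/-- The tangent space of a sphere of `E` at the point `x`, as the subspace `x^⊥` of `E`. -/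
abbrev Tan (x : E) : Submodule ℝ E := (ℝ ∙ x)ᗮ

/-- The orthogonal projection of the ambient space onto the tangent space at `x`. -/
def tanProj (x : E) (v : E) : Tan x := (Tan x).orthogonalProjectionOnto v

/-- The identification of the tangent space of the manifold `S^m` at `x` with `x^⊥`, given by the
differential of the inclusion of the sphere into the ambient Euclidean space. -/
def tanEquiv (m : ℕ) [Fact (finrank ℝ E = m + 1)] (x : Sph E 1) :
    TangentSpace (𝓡 m) x ≃ₗ[ℝ] Tan (x : E) :=
  (LinearEquiv.ofInjective
    (mvfderiv (𝓡 m) ((↑) : Sph E 1 → E) x : TangentSpace (𝓡 m) x →ₗ[ℝ] E)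
    (injective_mvfderiv_subtypeVal_sphere x)).trans
    (LinearEquiv.ofEq _ _ (range_mvfderiv_subtypeVal x))

/-- The differential at `x ∈ S^m` of a map from `S^m` to a vector space, in the direction `u`. -/
def sphD (m : ℕ) [Fact (finrank ℝ E = m + 1)] (s : Sph E 1 → F) (x : Sph E 1)
    (u : Tan (x : E)) : F :=
  mvfderiv (𝓡 m) s x ((tanEquiv m x).symm u)

/-- The differential `dφ` at `x` of a map `φ` between unit spheres. -/
def dmap (m : ℕ) [Fact (finrank ℝ E = m + 1)] (φ : Sph E 1 → Sph F 1) (x : Sph E 1)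
    (u : Tan (x : E)) : F :=
  sphD m (fun y => (φ y : F)) x u

/-- The pull-back connection `∇^φ_u s` at `x`, for a section `s` of `φ⁻¹ T S^n`: the Levi-Civita
connection of the sphere, pulled back by `φ`, is the tangential part of the flat connection of the
ambient Euclidean space. Sections are written as maps `s` into the ambient space with
`s x ∈ T_{φ x} S^n`. -/
def covAlong (m : ℕ) [Fact (finrank ℝ E = m + 1)] (φ : Sph E 1 → Sph F 1) (s : Sph E 1 → F)
    (x : Sph E 1) (u : Tan (x : E)) : Tan (φ x : F) :=
  tanProj (φ x : F) (sphD m s x u)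

/-- The Levi-Civita connection `∇_u X` of the unit sphere, for a tangent vector field `X`. -/
def leviCivita (m : ℕ) [Fact (finrank ℝ E = m + 1)] (X : Sph E 1 → E) (x : Sph E 1)
    (u : Tan (x : E)) : Tan (x : E) :=
  covAlong m id X x u

/-- A tangent vector field on the sphere extending a given tangent vector `v`: the tangential part
of the constant vector field `v`. All the tensors below are independent of the extension. -/
def tanExt (v : E) (y : Sph E 1) : Tan (y : E) := tanProj (y : E) v

/-- The Hessian `(∇² s)(u, v) = ∇^φ_U ∇^φ_V s - ∇^φ_{∇_U V} s` of a section `s` along `φ`. -/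
def covHess (m : ℕ) [Fact (finrank ℝ E = m + 1)] (φ : Sph E 1 → Sph F 1) (s : Sph E 1 → F)
    (x : Sph E 1) (u v : Tan (x : E)) : F :=
  covAlong m φ (fun y => (covAlong m φ s y (tanExt (v : E) y) : F)) x u
    - covAlong m φ s x (leviCivita m (fun y => (tanExt (v : E) y : E)) x u)

/-- The second fundamental form `(∇ dφ)(u, v) = ∇^φ_U dφ(V) - dφ(∇_U V)` of a map `φ`. -/
def secondFF (m : ℕ) [Fact (finrank ℝ E = m + 1)] (φ : Sph E 1 → Sph F 1)
    (x : Sph E 1) (u v : Tan (x : E)) : F :=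
  covAlong m φ (fun y => dmap m φ y (tanExt (v : E) y)) x u
    - dmap m φ x (leviCivita m (fun y => (tanExt (v : E) y : E)) x u)

/-- The trace of a bilinear form on `T_x S^m`, computed in an orthonormal basis. -/
def tanTrace [FiniteDimensional ℝ E] (x : E) (B : Tan x → Tan x → F) : F :=
  ∑ i, B (stdOrthonormalBasis ℝ (Tan x) i) (stdOrthonormalBasis ℝ (Tan x) i)

/-- The Lie bracket `[X, Y]` of two tangent vector fields on the sphere. The ambient expression
`dY(X) - dX(Y)` is already tangent; the projection only records this. -/
def lieBr (m : ℕ) [Fact (finrank ℝ E = m + 1)] (X Y : (y : Sph E 1) → Tan (y : E))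
    (x : Sph E 1) : Tan (x : E) :=
  tanProj (x : E) (sphD m (fun y => (Y y : E)) x (X x) - sphD m (fun y => (X y : E)) x (Y x))

/-- The curvature tensor `R(u, v) w = ∇_U ∇_V W - ∇_V ∇_U W - ∇_{[U, V]} W` of the unit sphere. -/
def curv (m : ℕ) [Fact (finrank ℝ E = m + 1)] (x : Sph E 1) (u v w : Tan (x : E)) : Tan (x : E) :=
  leviCivita m (fun y => (leviCivita m (fun z => (tanExt (w : E) z : E)) y (tanExt (v : E) y) : E))
      x u
    - leviCivita m
      (fun y => (leviCivita m (fun z => (tanExt (w : E) z : E)) y (tanExt (u : E) y) : E)) x v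
    - leviCivita m (fun z => (tanExt (w : E) z : E)) x
        (lieBr m (tanExt (u : E)) (tanExt (v : E)) x)

variable [FiniteDimensional ℝ E]

/-- The rough Laplacian `Δ s = - trace ∇² s` on sections of `φ⁻¹ T S^n`. -/
def roughLaplacian (m : ℕ) [Fact (finrank ℝ E = m + 1)] (φ : Sph E 1 → Sph F 1)
    (s : Sph E 1 → F) (x : Sph E 1) : F :=
  -tanTrace (x : E) (covHess m φ s x)

/-- The tension field `τ(φ) = trace ∇ dφ`. -/
def tension (m : ℕ) [Fact (finrank ℝ E = m + 1)] (φ : Sph E 1 → Sph F 1) (x : Sph E 1) : F :=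
  tanTrace (x : E) (secondFF m φ x)

/-- The bitension field `τ₂(φ) = - Δ τ(φ) - trace R(dφ ·, τ(φ)) dφ ·` of a map `S^m → S^n`.
The vectors `dφ(u)` and `τ(φ)` are tangent to the target sphere, so that projecting them to its
tangent space does not change them. -/
def bitension (m n : ℕ) [Fact (finrank ℝ E = m + 1)] [Fact (finrank ℝ F = n + 1)]
    (φ : Sph E 1 → Sph F 1) (x : Sph E 1) : F :=
  -roughLaplacian m φ (tension m φ) x
    - tanTrace (x : E) (fun u v =>
        (curv n (φ x) (tanProj (φ x : F) (dmap m φ x u)) (tanProj (φ x : F) (tension m φ x))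
          (tanProj (φ x : F) (dmap m φ x v)) : F))

/-- A harmonic map `S^m → S^n`: a smooth map whose tension field vanishes. -/
def IsHarmonicMap (m n : ℕ) [Fact (finrank ℝ E = m + 1)] [Fact (finrank ℝ F = n + 1)]
    (φ : Sph E 1 → Sph F 1) : Prop :=
  ContMDiff (𝓡 m) (𝓡 n) ∞ φ ∧ ∀ x, tension m φ x = 0

/-- A biharmonic map `S^m → S^n`: a smooth map whose bitension field vanishes. -/
def IsBiharmonicMap (m n : ℕ) [Fact (finrank ℝ E = m + 1)] [Fact (finrank ℝ F = n + 1)]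
    (φ : Sph E 1 → Sph F 1) : Prop :=
  ContMDiff (𝓡 m) (𝓡 n) ∞ φ ∧ ∀ x, bitension m n φ x = 0

/-- A proper biharmonic map: biharmonic, but not harmonic. -/
def IsProperBiharmonic (m n : ℕ) [Fact (finrank ℝ E = m + 1)] [Fact (finrank ℝ F = n + 1)]
    (φ : Sph E 1 → Sph F 1) : Prop :=
  IsBiharmonicMap m n φ ∧ ¬ IsHarmonicMap m n φ

end Geometry

/-- A form of degree `k`: a map `ℝ^(m+1) → ℝ^(n+1)` each of whose components is a homogeneous
polynomial of degree `k`. -/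
def IsForm {m n : ℕ} (k : ℕ) (F : Euc m → Euc n) : Prop :=
  ∀ j, ∃ p : MvPolynomial (Fin (m + 1)) ℝ, p.IsHomogeneous k ∧
    ∀ x, F x j = MvPolynomial.eval (fun i => x i) p

instance finrank_euc (n : ℕ) : Fact (finrank ℝ (Euc n) = n + 1) := ⟨by simp⟩

/-- The Euclidean space `ℝ^(n₁+1) × ℝ^(n₂+1) = ℝ^(n₁+n₂+2)`, with its Euclidean norm. -/
abbrev EucProd (n₁ n₂ : ℕ) : Type := WithLp 2 (Euc n₁ × Euc n₂)

instance finrank_eucProd (n₁ n₂ : ℕ) : Fact (finrank ℝ (EucProd n₁ n₂) = (n₁ + n₂ + 1) + 1) :=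
  ⟨by
    rw [(WithLp.linearEquiv 2 ℝ (Euc n₁ × Euc n₂)).finrank_eq]
    simp
    omega⟩

/-- The canonical inclusion of `S^{n₁}(r₁) × S^{n₂}(r₂)` into the unit sphere `S^{n₁+n₂+1}`, for
`r₁² + r₂² = 1`. -/
def prodIncl {n₁ n₂ : ℕ} {r₁ r₂ : ℝ} (hr : r₁ ^ 2 + r₂ ^ 2 = 1)
    (p : Sph (Euc n₁) r₁ × Sph (Euc n₂) r₂) : Sph (EucProd n₁ n₂) 1 :=
  ⟨WithLp.toLp 2 ((p.1 : Euc n₁), (p.2 : Euc n₂)), by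
    have h₁ : ‖(p.1 : Euc n₁)‖ = r₁ := by simp
    have h₂ : ‖(p.2 : Euc n₂)‖ = r₂ := by simp
    rw [mem_sphere_zero_iff_norm, WithLp.prod_norm_eq_of_L2]
    simp [h₁, h₂, hr]⟩

end SphereMaps

end

open SphereMaps

namespace SphereMaps

open Module RealInnerProductSpace

/-! ### Connections, curvature and Hessians on spheres via ambient extensions. -/

section General

variable {E : Type*} [NormedAddCommGroup E] [InnerProductSpace ℝ E]
variable {F : Type*} [NormedAddCommGroup F] [InnerProductSpace ℝ F]

/-! Write λᵢ = kᵢ(kᵢ + m - 1). By Euler's identity a harmonic form of degree kᵢ restricts to an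
eigenmap of the sphere: the trace of its spherical Hessian is -λᵢΦᵢ
(`tanTrace_hessian_of_harmonic`). All covariant derivatives are tangential projections of ambient
ones. So τ(φ) is the tangential part of (-λ₁Φ₁, -λ₂Φ₂), namely δ(-r₂²Φ₁, r₁²Φ₂) with δ = λ₁ - λ₂ =
(k₁ - k₂)(m + k₁ + k₂ - 1).

This is again a pair of multiples of Φ₁, Φ₂, so the same eigenvalue computation gives its rough
Laplacian. As |Φᵢ| is constant, Φᵢ ⟂ dΦᵢ, hence τ ⟂ dφ. Constant curvature one then reduces the
curvature trace to -|dφ|²τ, where |dφ|² = λ₁r₁² + λ₂r₂². Adding up gives the formula of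
`bitension_eq`, with factor (2r₁² - 1)δ².

Since Φ₂ and r₁ do not vanish, harmonicity means δ = 0 and biharmonicity means δ = 0 or 2r₁² = 1;
for m ≥ 1, δ = 0 exactly when k₁ = k₂. -/

theorem inner_tan (x : E) (u : Tan x) : ⟪x, (u : E)⟫ = 0 :=
  Submodule.mem_orthogonal_singleton_iff_inner_right.1 u.2

theorem coe_tanProj {x : E} (hx : ‖x‖ = 1) (v : E) : (tanProj x v : E) = v - ⟪x, v⟫ • x := by
  have h := Submodule.starProjection_orthogonal_val (K := (ℝ ∙ x)) v
  rw [Submodule.starProjection_unit_singleton ℝ hx] at h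
  exact h

theorem coe_tanProj_of_inner_eq_zero {x : E} (hx : ‖x‖ = 1) {v : E} (hv : ⟪x, v⟫ = 0) :
    (tanProj x v : E) = v := by
  rw [coe_tanProj hx, hv, zero_smul, sub_zero]

theorem norm_sph {E : Type*} [NormedAddCommGroup E] (x : Sph E 1) : ‖(x : E)‖ = 1 := by simp

/-- The differential on the sphere of the restriction of an ambient map is the restriction of its
Fréchet derivative. -/
theorem sphD_eq_fderiv (m : ℕ) [Fact (finrank ℝ E = m + 1)] {s : Sph E 1 → F} {G : E → F}
    (hs : ∀ y : Sph E 1, s y = G y) {x : Sph E 1} (hG : DifferentiableAt ℝ G (x : E))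
    (u : Tan (x : E)) : sphD m s x u = fderiv ℝ G x u := by
  have hc : MDifferentiableAt (𝓡 m) 𝓘(ℝ, E) ((↑) : Sph E 1 → E) x :=
    (contMDiff_coe_sphere (m := 1) x).mdifferentiableAt one_ne_zero
  have hs' : s = G ∘ ((↑) : Sph E 1 → E) := funext hs
  have hu : mvfderiv (𝓡 m) ((↑) : Sph E 1 → E) x ((tanEquiv m x).symm u) = (u : E) := by
    have h := congrArg Subtype.val ((tanEquiv m x).apply_symm_apply u)
    exact h
  have h := mfderiv_comp_apply x hG.mdifferentiableAt hc ((tanEquiv m x).symm u)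
  rw [mfderiv_eq_fderiv] at h
  rw [sphD, hs', ← hu]
  exact h

theorem covAlong_eq (m : ℕ) [Fact (finrank ℝ E = m + 1)] (φ : Sph E 1 → Sph F 1)
    {s : Sph E 1 → F} {G : E → F}
    (hs : ∀ y : Sph E 1, s y = G y) {x : Sph E 1} (hG : DifferentiableAt ℝ G (x : E))
    (u : Tan (x : E)) : covAlong m φ s x u = tanProj (φ x : F) (fderiv ℝ G x u) := by
  rw [covAlong, sphD_eq_fderiv m hs hG]

theorem leviCivita_eq (m : ℕ) [Fact (finrank ℝ E = m + 1)] {X : Sph E 1 → E} {G : E → E}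
    (hX : ∀ y : Sph E 1, X y = G y) {x : Sph E 1} (hG : DifferentiableAt ℝ G (x : E))
    (u : Tan (x : E)) : leviCivita m X x u = tanProj (x : E) (fderiv ℝ G x u) :=
  covAlong_eq m id hX hG u

theorem coe_tanExt (v : E) (y : Sph E 1) : (tanExt v y : E) = v - ⟪(y : E), v⟫ • (y : E) :=
  coe_tanProj (norm_sph y) v

theorem hasFDerivAt_sub_inner_smul (v x : E) :
    HasFDerivAt (fun y : E => v - ⟪y, v⟫ • y)
      (-(⟪x, v⟫ • ContinuousLinearMap.id ℝ E + (innerSL ℝ v).smulRight x)) x := by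
  have h1 : HasFDerivAt (fun y : E => ⟪y, v⟫) (innerSL ℝ v) x := by
    have := (innerSL ℝ v).hasFDerivAt (x := x)
    refine this.congr_of_eventuallyEq (Filter.Eventually.of_forall fun y => ?_)
    exact real_inner_comm _ _
  simpa using (h1.smul (hasFDerivAt_id x)).const_sub v

/-- The derivative of y ↦ w - ⟪y, w⟫y along u is -⟪x, w⟫u - ⟪u, w⟫x, and the projection kills the
radial term. Here w need not be tangent at x, so the formula holds at every point and can be
differentiated again. -/
theorem coe_leviCivita_tanExt (m : ℕ) [Fact (finrank ℝ E = m + 1)] (w : E) (x : Sph E 1)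
    (u : Tan (x : E)) :
    (leviCivita m (fun y => (tanExt w y : E)) x u : E) = -⟪(x : E), w⟫ • (u : E) := by
  have h := hasFDerivAt_sub_inner_smul w (x : E)
  rw [leviCivita_eq m (coe_tanExt w) h.differentiableAt, h.fderiv,
    coe_tanProj (norm_sph x)]
  simp [inner_add_right, inner_smul_right, inner_neg_right, inner_tan]

/-- The extension is parallel at its base point. This removes the terms in ∇_U V from both Hessians
and the bracket term from the curvature. -/
theorem leviCivita_tanExt_eq_zero (m : ℕ) [Fact (finrank ℝ E = m + 1)] (x : Sph E 1)
    (u w : Tan (x : E)) :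
    leviCivita m (fun y => (tanExt (w : E) y : E)) x u = 0 := by
  ext
  rw [coe_leviCivita_tanExt, inner_tan]
  simp

/-- The inner field is -⟪y, w⟫V(y), whose scalar factor vanishes at x; only the derivative of that
factor survives. -/
theorem coe_leviCivita_leviCivita_tanExt (m : ℕ) [Fact (finrank ℝ E = m + 1)] (x : Sph E 1)
    (u v w : Tan (x : E)) :
    (leviCivita m
      (fun y => (leviCivita m (fun z => (tanExt (w : E) z : E)) y (tanExt (v : E) y) : E)) x u : E)
      = -⟪(u : E), (w : E)⟫ • (v : E) := by
  have h1 : HasFDerivAt (fun y : E => -⟪y, (w : E)⟫) (-innerSL ℝ (w : E)) (x : E) := by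
    have := ((innerSL ℝ (w : E)).hasFDerivAt (x := (x : E))).neg
    refine this.congr_of_eventuallyEq (Filter.Eventually.of_forall fun y => ?_)
    simp [real_inner_comm]
  have h := h1.smul (hasFDerivAt_sub_inner_smul (v : E) (x : E))
  rw [leviCivita_eq m (fun y => by rw [coe_leviCivita_tanExt, coe_tanExt]; rfl)
    h.differentiableAt, h.fderiv, coe_tanProj (norm_sph x)]
  simp [inner_tan, inner_smul_right, real_inner_comm]

/-- The unit sphere has constant sectional curvature one. -/
theorem coe_curv (m : ℕ) [Fact (finrank ℝ E = m + 1)] (x : Sph E 1) (u v w : Tan (x : E)) :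
    (curv m x u v w : E) = ⟪(v : E), (w : E)⟫ • (u : E) - ⟪(u : E), (w : E)⟫ • (v : E) := by
  rw [curv, leviCivita_tanExt_eq_zero, sub_zero, Submodule.coe_sub,
    coe_leviCivita_leviCivita_tanExt, coe_leviCivita_leviCivita_tanExt]
  simp only [neg_smul]
  abel

/-! ### Hessians and their traces. -/

theorem hasFDerivAt_fderiv_tanExt {G : E → F} (hG : ContDiff ℝ 2 G) (v x : E) :
    HasFDerivAt (fun y : E => fderiv ℝ G y (v - ⟪y, v⟫ • y))
      ((fderiv ℝ G x).comp (-(⟪x, v⟫ • ContinuousLinearMap.id ℝ E + (innerSL ℝ v).smulRight x))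
        + (fderiv ℝ (fderiv ℝ G) x).flip (v - ⟪x, v⟫ • x)) x :=
  HasFDerivAt.clm_apply
    ((hG.fderiv_right (m := 1) le_rfl).differentiable one_ne_zero x).hasFDerivAt
    (hasFDerivAt_sub_inner_smul v x)

/-- The Hessian on the sphere of the restriction of an ambient map. -/
theorem fderiv_fderiv_tanExt {G : E → F} (hG : ContDiff ℝ 2 G) (x : E) (u v : Tan x) :
    fderiv ℝ (fun y : E => fderiv ℝ G y ((v : E) - ⟪y, (v : E)⟫ • y)) x u
      = fderiv ℝ (fderiv ℝ G) x u v - ⟪(u : E), (v : E)⟫ • fderiv ℝ G x x := by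
  rw [(hasFDerivAt_fderiv_tanExt hG (v : E) x).fderiv]
  simp [inner_tan, real_inner_comm]
  abel

theorem dmap_eq (m : ℕ) [Fact (finrank ℝ E = m + 1)] {φ : Sph E 1 → Sph F 1} {G : E → F}
    (hφ : ∀ y : Sph E 1, (φ y : F) = G y) (hG : Differentiable ℝ G) (x : Sph E 1)
    (u : Tan (x : E)) : dmap m φ x u = fderiv ℝ G x u :=
  sphD_eq_fderiv m hφ (hG x) u

theorem secondFF_eq (m : ℕ) [Fact (finrank ℝ E = m + 1)] {φ : Sph E 1 → Sph F 1} {G : E → F}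
    (hφ : ∀ y : Sph E 1, (φ y : F) = G y) (hG : ContDiff ℝ 2 G) (x : Sph E 1)
    (u v : Tan (x : E)) :
    secondFF m φ x u v = tanProj (φ x : F)
      (fderiv ℝ (fderiv ℝ G) x u v - ⟪(u : E), (v : E)⟫ • fderiv ℝ G x x) := by
  have hd := hG.differentiable two_ne_zero
  rw [secondFF, leviCivita_tanExt_eq_zero, dmap_eq m hφ hd, Submodule.coe_zero, map_zero, sub_zero,
    ← fderiv_fderiv_tanExt hG]
  rw [covAlong_eq m φ (fun y => ?_) (hasFDerivAt_fderiv_tanExt hG (v : E) x).differentiableAt]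
  rw [dmap_eq m hφ hd, coe_tanExt]

/-- By `hort` the ambient derivative of the section is already tangent to the target, so the inner
projection is the identity and need not be differentiated. -/
theorem covHess_eq (m : ℕ) [Fact (finrank ℝ E = m + 1)] {φ : Sph E 1 → Sph F 1}
    {s : Sph E 1 → F} {G : E → F} (hs : ∀ y : Sph E 1, s y = G y) (hG : ContDiff ℝ 2 G)
    (hort : ∀ (y : Sph E 1) (u : Tan (y : E)), ⟪(φ y : F), fderiv ℝ G y u⟫ = 0) (x : Sph E 1)
    (u v : Tan (x : E)) :
    covHess m φ s x u v = tanProj (φ x : F)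
      (fderiv ℝ (fderiv ℝ G) x u v - ⟪(u : E), (v : E)⟫ • fderiv ℝ G x x) := by
  have hd := hG.differentiable two_ne_zero
  rw [covHess, leviCivita_tanExt_eq_zero, covAlong_eq m φ hs (hd x), Submodule.coe_zero, map_zero,
    ← fderiv_fderiv_tanExt hG]
  rw [covAlong_eq m φ (fun y => ?_) (hasFDerivAt_fderiv_tanExt hG (v : E) x).differentiableAt]
  · simp [tanProj]
  · rw [covAlong_eq m φ hs (hd y), coe_tanProj_of_inner_eq_zero (norm_sph _) (hort y _),
      coe_tanExt]

theorem tanTrace_tanProj [FiniteDimensional ℝ E] (x : E) (z : F) (B : Tan x → Tan x → F) :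
    tanTrace x (fun u v => (tanProj z (B u v) : F)) = tanProj z (tanTrace x B) := by
  simp [tanTrace, tanProj]

/-- The Laplacian is the trace over the tangent space of the sphere plus the radial term. -/
theorem laplacian_eq_tanTrace [FiniteDimensional ℝ E] {x : E} (hx : ‖x‖ = 1) (G : E → F) :
    Laplacian.laplacian G x = tanTrace x (fun u v => fderiv ℝ (fderiv ℝ G) x u v)
      + fderiv ℝ (fderiv ℝ G) x x x := by
  let b := stdOrthonormalBasis ℝ (Tan x)
  have hb : Orthonormal ℝ fun i => (b i : E) :=
    b.orthonormal.comp_linearIsometry (Tan x).subtypeₗᵢ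
  -- The unit normal x completes an orthonormal basis of the tangent space to one of `E`.
  let e : Option (Fin (finrank ℝ (Tan x))) → E := fun o => o.elim x fun i => (b i : E)
  have he : Orthonormal ℝ e := by
    rw [orthonormal_iff_ite] at hb ⊢
    rintro (_ | i) (_ | j)
    · simp [e, hx]
    · simpa [e] using inner_tan x (b j)
    · simpa [e, real_inner_comm] using inner_tan x (b i)
    · simpa [e] using hb i j
  have hcard : Fintype.card (Option (Fin (finrank ℝ (Tan x)))) = finrank ℝ E := by
    have h := Submodule.finrank_add_finrank_orthogonal (ℝ ∙ x)
    rw [finrank_span_singleton (norm_ne_zero_iff.1 (by simp [hx]))] at h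
    rw [Fintype.card_option, Fintype.card_fin, ← h, add_comm]
  let B : OrthonormalBasis (Option (Fin (finrank ℝ (Tan x)))) ℝ E :=
    (basisOfOrthonormalOfCardEqFinrank he hcard).toOrthonormalBasis (by simpa using he)
  rw [InnerProductSpace.laplacian_eq_iteratedFDeriv_orthonormalBasis G B]
  simp [B, e, b, tanTrace, iteratedFDeriv_two_apply, Fintype.sum_option, add_comm]

theorem tanTrace_inner_smul [FiniteDimensional ℝ E] (m : ℕ) [Fact (finrank ℝ E = m + 1)] {x : E}
    (hx : ‖x‖ = 1) (c : F) :
    tanTrace x (fun u v => ⟪(u : E), (v : E)⟫ • c) = (m : ℝ) • c := by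
  have hb (i) : ‖((stdOrthonormalBasis ℝ (Tan x) i : Tan x) : E)‖ = 1 :=
    (stdOrthonormalBasis ℝ (Tan x)).orthonormal.1 i
  have hf : finrank ℝ (Tan x) = m :=
    Submodule.finrank_orthogonal_span_singleton (norm_ne_zero_iff.1 (by simp [hx]))
  simp [tanTrace, hb, hf, ← Nat.cast_smul_eq_nsmul ℝ]

/-- Euler's identity: differentiate G(tx) = tᵏG(x) at t = 1. -/
theorem fderiv_self_of_homogeneous {G : E → F} {k : ℕ} (hk : ∀ (t : ℝ) x, G (t • x) = t ^ k • G x)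
    (hG : Differentiable ℝ G) (x : E) : fderiv ℝ G x x = (k : ℝ) • G x := by
  have h1 : HasDerivAt (fun t : ℝ => G (t • x)) (fderiv ℝ G x x) 1 := by
    have h := (hasDerivAt_id (1 : ℝ)).smul_const x
    have hG' : HasFDerivAt G (fderiv ℝ G x) ((1 : ℝ) • x) := by
      rw [one_smul]; exact (hG x).hasFDerivAt
    simpa [Function.comp_def] using hG'.comp_hasDerivAt (1 : ℝ) h
  have h2 : HasDerivAt (fun t : ℝ => t ^ k • G x) ((k : ℝ) • G x) 1 := by
    simpa using (hasDerivAt_pow k (1 : ℝ)).smul_const (G x)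
  simp only [hk] at h1
  exact h1.unique h2

/-- Differentiate Euler's identity DG(y)y = kG(y) once more, in the direction x. -/
theorem fderiv_fderiv_self_of_homogeneous {G : E → F} {k : ℕ}
    (hk : ∀ (t : ℝ) x, G (t • x) = t ^ k • G x) (hG : ContDiff ℝ 2 G) (x : E) :
    fderiv ℝ (fderiv ℝ G) x x x = ((k : ℝ) * (k - 1)) • G x := by
  have hd := hG.differentiable two_ne_zero
  have h1 : HasFDerivAt (fun y => fderiv ℝ G y y) ((fderiv ℝ G x).comp (.id ℝ E)
      + (fderiv ℝ (fderiv ℝ G) x).flip x) x :=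
    ((hG.fderiv_right (m := 1) le_rfl).differentiable one_ne_zero x).hasFDerivAt.clm_apply
      (hasFDerivAt_id x)
  have h2 : HasFDerivAt (fun y => fderiv ℝ G y y) ((k : ℝ) • fderiv ℝ G x) x := by
    simp only [fderiv_self_of_homogeneous hk hd]
    exact (hd x).hasFDerivAt.const_smul _
  have h := congrArg (fun L : E →L[ℝ] F => L x) (h1.unique h2)
  simp only [add_apply, ContinuousLinearMap.comp_apply,
    ContinuousLinearMap.id_apply, ContinuousLinearMap.flip_apply, smul_apply,
    fderiv_self_of_homogeneous hk hd] at h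
  rw [mul_sub, sub_smul, ← smul_smul, mul_one, ← h]
  abel

/-- A homogeneous harmonic map restricts to an eigenmap of the Laplacian of the sphere. -/
theorem tanTrace_hessian_of_harmonic [FiniteDimensional ℝ E] (m : ℕ)
    [Fact (finrank ℝ E = m + 1)] {G : E → F} {k : ℕ}
    (hk : ∀ (t : ℝ) x, G (t • x) = t ^ k • G x) (hG : ContDiff ℝ 2 G) {x : E} (hx : ‖x‖ = 1)
    (hΔ : Laplacian.laplacian G x = 0) :
    tanTrace x (fun u v => fderiv ℝ (fderiv ℝ G) x u v - ⟪(u : E), (v : E)⟫ • fderiv ℝ G x x)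
      = -((k : ℝ) * (k + m - 1)) • G x := by
  have h1 := laplacian_eq_tanTrace hx G
  have h2 := tanTrace_inner_smul m hx (fderiv ℝ G x x)
  rw [hΔ, fderiv_fderiv_self_of_homogeneous hk hG] at h1
  rw [fderiv_self_of_homogeneous hk (hG.differentiable two_ne_zero)] at h2 ⊢
  simp only [tanTrace, Finset.sum_sub_distrib] at h1 h2 ⊢
  -- The ambient Hessian contributes -k(k - 1)G and the radial derivative -mkG.
  rw [h2, eq_neg_of_add_eq_zero_left h1.symm]
  module

/-- A map of constant norm on the sphere is orthogonal to its differential. -/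
theorem inner_fderiv_of_norm_eq (m : ℕ) [Fact (finrank ℝ E = m + 1)] {G : E → F}
    (hG : Differentiable ℝ G) {r : ℝ} (hr : ∀ y : Sph E 1, ‖G y‖ = r) (x : Sph E 1)
    (u : Tan (x : E)) : ⟪G x, fderiv ℝ G x u⟫ = 0 := by
  -- On the sphere the constant r² has two ambient extensions, ⟪G, G⟫ and r²; their derivatives
  -- agree on tangent vectors.
  have h1 := sphD_eq_fderiv m (s := fun _ : Sph E 1 => r ^ 2) (G := fun y => ⟪G y, G y⟫)
    (fun y => by rw [real_inner_self_eq_norm_sq, hr]) (x := x)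
    ((hG x).inner ℝ (hG x)) u
  have h2 := sphD_eq_fderiv m (s := fun _ : Sph E 1 => r ^ 2) (G := fun _ => r ^ 2)
    (fun _ => rfl) (x := x) (differentiableAt_const _) u
  rw [h1, fderiv_inner_apply ℝ (hG x) (hG x)] at h2
  simpa [real_inner_comm] using h2

/-- The energy density of a map of constant norm on the sphere. -/
theorem tanTrace_inner_fderiv [FiniteDimensional ℝ E] (m : ℕ) [Fact (finrank ℝ E = m + 1)]
    {G : E → F} (hG : ContDiff ℝ 2 G) {r : ℝ} (hr : ∀ y : Sph E 1, ‖G y‖ = r) (x : Sph E 1) :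
    tanTrace (x : E) (fun u v => ⟪fderiv ℝ G x u, fderiv ℝ G x v⟫)
      = -⟪G x, tanTrace (x : E) (fun u v => fderiv ℝ (fderiv ℝ G) x u v
          - ⟪(u : E), (v : E)⟫ • fderiv ℝ G x x)⟫ := by
  have hd := hG.differentiable two_ne_zero
  rw [tanTrace, tanTrace, inner_sum, ← Finset.sum_neg_distrib]
  refine Finset.sum_congr rfl fun i _ => ?_
  generalize stdOrthonormalBasis ℝ (Tan (x : E)) i = v
  have hD := hasFDerivAt_fderiv_tanExt hG (v : E) x
  -- ⟪G, DG(V)⟫ vanishes on the sphere. Differentiating it along v gives |DG(v)|² plus the pairing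
  -- of G with the spherical Hessian.
  have h1 := sphD_eq_fderiv m (s := fun _ : Sph E 1 => (0 : ℝ))
    (G := fun y => ⟪G y, fderiv ℝ G y ((v : E) - ⟪y, (v : E)⟫ • y)⟫)
    (fun y => by rw [← coe_tanExt, inner_fderiv_of_norm_eq m hd hr]) (x := x)
    ((hd x).inner ℝ hD.differentiableAt) v
  have h2 := sphD_eq_fderiv m (s := fun _ : Sph E 1 => (0 : ℝ)) (G := fun _ => 0)
    (fun _ => rfl) (x := x) (differentiableAt_const _) v
  rw [h1, fderiv_inner_apply ℝ (hd x) hD.differentiableAt, fderiv_fderiv_tanExt hG, inner_tan] at h2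
  simp only [zero_smul, sub_zero, fderiv_fun_const, Pi.zero_apply,
    zero_apply] at h2
  linarith

end General

/-! ### Pairs of spherical forms: tension and bitension. -/

section Prod

variable {E : Type*} [NormedAddCommGroup E] [InnerProductSpace ℝ E]
variable {V₁ : Type*} [NormedAddCommGroup V₁] [InnerProductSpace ℝ V₁]
variable {V₂ : Type*} [NormedAddCommGroup V₂] [InnerProductSpace ℝ V₂]

/-- A homogeneous harmonic map of degree `k` that takes the unit sphere to the sphere of
radius `r`. -/
structure IsSphericalForm [FiniteDimensional ℝ E] {V : Type*} [NormedAddCommGroup V]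
    [InnerProductSpace ℝ V] (k : ℕ) (r : ℝ) (G : E → V) : Prop where
  contDiff : ContDiff ℝ ∞ G
  homogeneous : ∀ (t : ℝ) (x : E), G (t • x) = t ^ k • G x
  laplacian : ∀ x, Laplacian.laplacian G x = 0
  norm : ∀ y : Sph E 1, ‖G y‖ = r

theorem IsSphericalForm.contDiff_two [FiniteDimensional ℝ E] {k : ℕ} {r : ℝ} {G : E → V₁}
    (h : IsSphericalForm k r G) : ContDiff ℝ 2 G :=
  h.contDiff.of_le (WithTop.coe_le_coe.2 (le_top : (2 : ℕ∞) ≤ ⊤))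

theorem IsSphericalForm.differentiable [FiniteDimensional ℝ E] {k : ℕ} {r : ℝ} {G : E → V₁}
    (h : IsSphericalForm k r G) : Differentiable ℝ G :=
  h.contDiff_two.differentiable two_ne_zero

/-- Makes the components of the tension field spherical forms too, so that the trace formula applies
to them. -/
theorem IsSphericalForm.const_smul [FiniteDimensional ℝ E] {k : ℕ} {r : ℝ} {G : E → V₁}
    (h : IsSphericalForm k r G) (a : ℝ) : IsSphericalForm k (|a| * r) (fun y => a • G y) where
  contDiff := h.contDiff.const_smul a
  homogeneous t x := by rw [h.homogeneous, smul_comm]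
  laplacian x := by
    have := InnerProductSpace.laplacian_smul a (h.contDiff_two.contDiffAt (x := x))
    rw [h.laplacian, smul_zero] at this
    exact this
  norm y := by rw [norm_smul, h.norm, Real.norm_eq_abs]

theorem contDiff_toLp_prodMk {G₁ : E → V₁} {G₂ : E → V₂} {n : WithTop ℕ∞} (h₁ : ContDiff ℝ n G₁)
    (h₂ : ContDiff ℝ n G₂) : ContDiff ℝ n (fun y => WithLp.toLp 2 (G₁ y, G₂ y)) :=
  (WithLp.prodContinuousLinearEquiv 2 ℝ V₁ V₂).symm.contDiff.comp (h₁.prodMk h₂)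

theorem fderiv_toLp_prodMk {G₁ : E → V₁} {G₂ : E → V₂} {x : E} (h₁ : DifferentiableAt ℝ G₁ x)
    (h₂ : DifferentiableAt ℝ G₂ x) (u : E) :
    fderiv ℝ (fun y => WithLp.toLp 2 (G₁ y, G₂ y)) x u
      = WithLp.toLp 2 (fderiv ℝ G₁ x u, fderiv ℝ G₂ x u) := by
  have h := (WithLp.prodContinuousLinearEquiv 2 ℝ V₁ V₂).symm.hasFDerivAt.comp x
    (h₁.hasFDerivAt.prodMk h₂.hasFDerivAt)
  exact congrArg (fun L => L u) h.fderiv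

theorem fderiv_fderiv_apply {G : E → V₁} (h : ContDiff ℝ 2 G) (x u v : E) :
    fderiv ℝ (fderiv ℝ G) x u v = fderiv ℝ (fun y => fderiv ℝ G y v) x u := by
  have hd := (h.fderiv_right (m := 1) le_rfl).differentiable one_ne_zero x
  rw [fderiv_clm_apply hd (differentiableAt_const v)]
  simp

theorem differentiableAt_fderiv_apply {G : E → V₁} (h : ContDiff ℝ 2 G) (v x : E) :
    DifferentiableAt ℝ (fun y => fderiv ℝ G y v) x :=
  ((h.fderiv_right (m := 1) le_rfl).differentiable one_ne_zero x).clm_apply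
    (differentiableAt_const v)

theorem fderiv_fderiv_toLp_prodMk {G₁ : E → V₁} {G₂ : E → V₂} (h₁ : ContDiff ℝ 2 G₁)
    (h₂ : ContDiff ℝ 2 G₂) (x u v : E) :
    fderiv ℝ (fderiv ℝ (fun y => WithLp.toLp 2 (G₁ y, G₂ y))) x u v
      = WithLp.toLp 2 (fderiv ℝ (fderiv ℝ G₁) x u v, fderiv ℝ (fderiv ℝ G₂) x u v) := by
  rw [fderiv_fderiv_apply (contDiff_toLp_prodMk h₁ h₂), fderiv_fderiv_apply h₁,
    fderiv_fderiv_apply h₂, ← fderiv_toLp_prodMk (differentiableAt_fderiv_apply h₁ v x)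
      (differentiableAt_fderiv_apply h₂ v x)]
  simp only [fderiv_toLp_prodMk (h₁.differentiable two_ne_zero _)
    (h₂.differentiable two_ne_zero _)]

theorem toLp_prod_sum {ι V₁ V₂ : Type*} [NormedAddCommGroup V₁] [NormedAddCommGroup V₂]
    (s : Finset ι) (f : ι → V₁) (g : ι → V₂) :
    ∑ i ∈ s, WithLp.toLp 2 (f i, g i) = WithLp.toLp 2 (∑ i ∈ s, f i, ∑ i ∈ s, g i) := by
  rw [← WithLp.toLp_sum]
  congr 1
  ext <;> simp [Prod.fst_sum, Prod.snd_sum]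

theorem inner_toLp_prodMk (a c : V₁) (b d : V₂) :
    ⟪WithLp.toLp 2 (a, b), WithLp.toLp 2 (c, d)⟫ = ⟪a, c⟫ + ⟪b, d⟫ :=
  WithLp.prod_inner_apply _ _

/-- The normal component is ar₁² + br₂², and a - (ar₁² + br₂²) = (a - b)r₂² because r₁² + r₂² = 1;
likewise for b. -/
theorem coe_tanProj_toLp_smul {r₁ r₂ : ℝ} (hr : r₁ ^ 2 + r₂ ^ 2 = 1) {v₁ : V₁} {v₂ : V₂}
    (h₁ : ‖v₁‖ = r₁) (h₂ : ‖v₂‖ = r₂) (a b : ℝ) :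
    (tanProj (WithLp.toLp 2 (v₁, v₂)) (WithLp.toLp 2 (a • v₁, b • v₂)) : WithLp 2 (V₁ × V₂))
      = WithLp.toLp 2 (((a - b) * r₂ ^ 2) • v₁, ((b - a) * r₁ ^ 2) • v₂) := by
  have hn : ‖WithLp.toLp 2 (v₁, v₂)‖ = 1 := by
    rw [WithLp.prod_norm_eq_of_L2]
    simp [h₁, h₂, hr]
  rw [coe_tanProj hn, inner_toLp_prodMk, inner_smul_right, inner_smul_right,
    real_inner_self_eq_norm_sq, real_inner_self_eq_norm_sq, h₁, h₂, ← WithLp.toLp_smul,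
    ← WithLp.toLp_sub, Prod.smul_mk, Prod.mk_sub_mk, ← sub_smul, ← sub_smul]
  congr 3
  · linear_combination (-a) * hr
  · linear_combination (-b) * hr

variable [FiniteDimensional ℝ E] {m : ℕ} [Fact (finrank ℝ E = m + 1)]
  {k₁ k₂ : ℕ} {r₁ r₂ : ℝ} {G₁ : E → V₁} {G₂ : E → V₂}
  {φ : Sph E 1 → Sph (WithLp 2 (V₁ × V₂)) 1}

theorem tanTrace_hessian_toLp_prodMk (h₁ : IsSphericalForm k₁ r₁ G₁)
    (h₂ : IsSphericalForm k₂ r₂ G₂) (x : Sph E 1) :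
    tanTrace (x : E) (fun u v =>
      fderiv ℝ (fderiv ℝ (fun y => WithLp.toLp 2 (G₁ y, G₂ y))) x u v
        - ⟪(u : E), (v : E)⟫ • fderiv ℝ (fun y => WithLp.toLp 2 (G₁ y, G₂ y)) x x)
      = WithLp.toLp 2 (-((k₁ : ℝ) * (k₁ + m - 1)) • G₁ x, -((k₂ : ℝ) * (k₂ + m - 1)) • G₂ x) := by
  rw [← tanTrace_hessian_of_harmonic m h₁.homogeneous h₁.contDiff_two (norm_sph x) (h₁.laplacian x),
    ← tanTrace_hessian_of_harmonic m h₂.homogeneous h₂.contDiff_two (norm_sph x) (h₂.laplacian x)]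
  simp only [tanTrace, ← toLp_prod_sum, fderiv_fderiv_toLp_prodMk h₁.contDiff_two h₂.contDiff_two,
    fderiv_toLp_prodMk (h₁.differentiable x) (h₂.differentiable x)]
  rfl

/-- The difference of the eigenvalues of the Laplacian of `S^m` for degrees `k₁` and `k₂`. -/
def eigGap (m k₁ k₂ : ℕ) : ℝ := ((k₁ : ℝ) - k₂) * ((m : ℝ) + k₁ + k₂ - 1)

theorem tension_eq (hr : r₁ ^ 2 + r₂ ^ 2 = 1) (h₁ : IsSphericalForm k₁ r₁ G₁)
    (h₂ : IsSphericalForm k₂ r₂ G₂)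
    (hφ : ∀ y, (φ y : WithLp 2 (V₁ × V₂)) = WithLp.toLp 2 (G₁ y, G₂ y)) (x : Sph E 1) :
    tension m φ x = WithLp.toLp 2
      ((-(eigGap m k₁ k₂ * r₂ ^ 2)) • G₁ x, (eigGap m k₁ k₂ * r₁ ^ 2) • G₂ x) := by
  have h : secondFF m φ x = fun u v => _ := funext₂ fun u v =>
    secondFF_eq m hφ (contDiff_toLp_prodMk h₁.contDiff_two h₂.contDiff_two) x u v
  rw [tension, h, tanTrace_tanProj, tanTrace_hessian_toLp_prodMk (m := m) h₁ h₂, hφ,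
    coe_tanProj_toLp_smul hr (h₁.norm x) (h₂.norm x)]
  congr 3 <;> (rw [eigGap]; ring)

theorem tanTrace_inner_dmap (h₁ : IsSphericalForm k₁ r₁ G₁) (h₂ : IsSphericalForm k₂ r₂ G₂)
    (hφ : ∀ y, (φ y : WithLp 2 (V₁ × V₂)) = WithLp.toLp 2 (G₁ y, G₂ y)) (x : Sph E 1) :
    tanTrace (x : E) (fun u v => ⟪dmap m φ x u, dmap m φ x v⟫)
      = k₁ * (k₁ + m - 1) * r₁ ^ 2 + k₂ * (k₂ + m - 1) * r₂ ^ 2 := by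
  have hG := contDiff_toLp_prodMk h₁.contDiff_two h₂.contDiff_two
  simp only [dmap_eq m hφ (hG.differentiable two_ne_zero)]
  rw [tanTrace_inner_fderiv m hG (r := 1) (fun y => by rw [← hφ]; exact norm_sph _),
    tanTrace_hessian_toLp_prodMk (m := m) h₁ h₂, inner_toLp_prodMk, inner_smul_right, inner_smul_right,
    real_inner_self_eq_norm_sq, real_inner_self_eq_norm_sq, h₁.norm, h₂.norm]
  ring

/-- Each block satisfies Φᵢ ⟂ dΦᵢ. Different coefficients give that dφ and the ambient derivative of
τ are orthogonal to φ, and that τ ⟂ dφ. -/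
theorem inner_toLp_smul_fderiv (m : ℕ) [Fact (finrank ℝ E = m + 1)]
    (h₁ : IsSphericalForm k₁ r₁ G₁) (h₂ : IsSphericalForm k₂ r₂ G₂)
    (a b c d : ℝ) (x : Sph E 1) (u : Tan (x : E)) :
    ⟪WithLp.toLp 2 (a • G₁ x, b • G₂ x),
      fderiv ℝ (fun y => WithLp.toLp 2 (c • G₁ y, d • G₂ y)) x u⟫ = 0 := by
  rw [fderiv_toLp_prodMk ((h₁.const_smul c).differentiable x) ((h₂.const_smul d).differentiable x),
    inner_toLp_prodMk, fderiv_fun_const_smul (h₁.differentiable x),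
    fderiv_fun_const_smul (h₂.differentiable x)]
  simp [inner_smul_left, inner_smul_right, inner_fderiv_of_norm_eq m h₁.differentiable h₁.norm,
    inner_fderiv_of_norm_eq m h₂.differentiable h₂.norm]

theorem bitension_eq {n : ℕ} [Fact (finrank ℝ (WithLp 2 (V₁ × V₂)) = n + 1)]
    (hr : r₁ ^ 2 + r₂ ^ 2 = 1) (h₁ : IsSphericalForm k₁ r₁ G₁) (h₂ : IsSphericalForm k₂ r₂ G₂)
    (hφ : ∀ y, (φ y : WithLp 2 (V₁ × V₂)) = WithLp.toLp 2 (G₁ y, G₂ y)) (x : Sph E 1) :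
    bitension m n φ x = ((2 * r₁ ^ 2 - 1) * eigGap m k₁ k₂ ^ 2) •
      WithLp.toLp 2 ((r₁ ^ 2 - 1) • G₁ x, r₁ ^ 2 • G₂ x) := by
  have hG := contDiff_toLp_prodMk h₁.contDiff_two h₂.contDiff_two
  set a := -(eigGap m k₁ k₂ * r₂ ^ 2) with ha
  set b := eigGap m k₁ k₂ * r₁ ^ 2 with hb
  have hτ := tension_eq (m := m) hr h₁ h₂ hφ
  have hGτ := contDiff_toLp_prodMk (h₁.const_smul a).contDiff_two (h₂.const_smul b).contDiff_two
  have hess : covHess m φ (tension m φ) x = fun u v => _ := funext₂ fun u v =>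
    covHess_eq m hτ hGτ (fun y u => by
      simpa [hφ] using inner_toLp_smul_fderiv m h₁ h₂ 1 1 a b y u) x u v
  have hd (u : Tan (x : E)) : dmap m φ x u = _ := dmap_eq m hφ (hG.differentiable two_ne_zero) x u
  have hd_orth (u : Tan (x : E)) : ⟪(φ x : WithLp 2 (V₁ × V₂)), dmap m φ x u⟫ = 0 := by
    simpa [hφ, hd] using inner_toLp_smul_fderiv m h₁ h₂ 1 1 1 1 x u
  have hτd (u : Tan (x : E)) : ⟪tension m φ x, dmap m φ x u⟫ = 0 := by
    rw [hτ, hd]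
    simpa only [one_smul] using inner_toLp_smul_fderiv m h₁ h₂ a b 1 1 x u
  have hτ_orth : ⟪(φ x : WithLp 2 (V₁ × V₂)), tension m φ x⟫ = 0 := by
    rw [hφ, hτ, inner_toLp_prodMk, inner_smul_right, inner_smul_right,
      real_inner_self_eq_norm_sq, real_inner_self_eq_norm_sq, h₁.norm, h₂.norm]
    ring
  -- R(dφ, τ)dφ = ⟪τ, dφ⟫dφ - |dφ|²τ, and the first term is zero.
  have hcurv : tanTrace (x : E) (fun u v =>
        (curv n (φ x) (tanProj (φ x : WithLp 2 (V₁ × V₂)) (dmap m φ x u))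
          (tanProj (φ x : WithLp 2 (V₁ × V₂)) (tension m φ x))
          (tanProj (φ x : WithLp 2 (V₁ × V₂)) (dmap m φ x v)) : WithLp 2 (V₁ × V₂)))
      = -((k₁ * (k₁ + m - 1) * r₁ ^ 2 + k₂ * (k₂ + m - 1) * r₂ ^ 2 : ℝ) • tension m φ x) := by
    rw [← tanTrace_inner_dmap h₁ h₂ hφ x]
    simp only [tanTrace, Finset.sum_smul, ← Finset.sum_neg_distrib, coe_curv,
      coe_tanProj_of_inner_eq_zero (norm_sph _) (hd_orth _),
      coe_tanProj_of_inner_eq_zero (norm_sph _) hτ_orth, hτd, zero_smul, zero_sub]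
  rw [bitension, hcurv, roughLaplacian, hess, tanTrace_tanProj,
    tanTrace_hessian_toLp_prodMk (m := m) (h₁.const_smul a) (h₂.const_smul b), hφ, smul_smul, smul_smul,
    coe_tanProj_toLp_smul hr (h₁.norm x) (h₂.norm x), neg_neg, sub_neg_eq_add, hτ,
    ← WithLp.toLp_smul, ← WithLp.toLp_smul, ← WithLp.toLp_add, Prod.smul_mk, Prod.smul_mk,
    Prod.mk_add_mk, smul_smul, smul_smul, smul_smul, smul_smul, ← add_smul, ← add_smul]
  have hr₂ : r₂ ^ 2 = 1 - r₁ ^ 2 := by linarith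
  -- In the first slot this is (-λ₁a + λ₂b)r₂² + |dφ|²a = δ²r₂²(r₂² - r₁²).
  congr 3 <;> (rw [ha, hb, hr₂, eigGap]; ring)

end Prod

/-! ### Polynomial forms and the final equivalence. -/

theorem IsForm.contDiff {m n k : ℕ} {F : Euc m → Euc n} (h : IsForm k F) : ContDiff ℝ ∞ F := by
  rw [contDiff_euclidean]
  intro j
  obtain ⟨p, -, hp⟩ := h j
  simp only [hp]
  clear hp
  induction p using MvPolynomial.induction_on with
  | C a => simpa using contDiff_const
  | add p q hp hq => simpa using hp.add hq
  | mul_X p i hp =>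
    have hi : ContDiff ℝ ∞ fun x : Euc m => x i :=
      (EuclideanSpace.proj (𝕜 := ℝ) i).contDiff
    simpa using hp.mul hi

theorem IsForm.homogeneous {m n k : ℕ} {F : Euc m → Euc n} (h : IsForm k F) (t : ℝ) (x : Euc m) :
    F (t • x) = t ^ k • F x := by
  ext j
  obtain ⟨p, hk, hp⟩ := h j
  rw [PiLp.smul_apply, hp, hp, smul_eq_mul, MvPolynomial.eval_eq', MvPolynomial.eval_eq',
    Finset.mul_sum]
  refine Finset.sum_congr rfl fun d hd => ?_
  have hdk : ∑ i, d i = k := by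
    rw [← Finsupp.degree_eq_sum, Finsupp.degree_eq_weight_one]
    exact hk (MvPolynomial.mem_support_iff.1 hd)
  simp only [PiLp.smul_apply, smul_eq_mul, mul_pow, Finset.prod_mul_distrib,
    Finset.prod_pow_eq_pow_sum, hdk]
  ring

theorem IsForm.isSphericalForm {m n k : ℕ} {r : ℝ} {F : Euc m → Euc n} (h : IsForm k F)
    (hΔ : InnerProductSpace.HarmonicOnNhd F Set.univ) {φ : Sph (Euc m) 1 → Sph (Euc n) r}
    (hφ : ∀ x : Sph (Euc m) 1, (φ x : Euc n) = F x) : IsSphericalForm k r F where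
  contDiff := h.contDiff
  homogeneous := h.homogeneous
  laplacian x := (hΔ x (Set.mem_univ x)).2.self_of_nhds
  norm y := by rw [← hφ]; exact mem_sphere_zero_iff_norm.1 (φ y).2

/-- Distinct degrees have sum at least 1, so m ≥ 1 makes the second factor positive. For m = 0 the
degrees 0 and 1 would give gap zero. -/
theorem eigGap_ne_zero {m k₁ k₂ : ℕ} (hm : 1 ≤ m) (hk : k₁ ≠ k₂) : eigGap m k₁ k₂ ≠ 0 := by
  refine mul_ne_zero (sub_ne_zero.2 (by exact_mod_cast hk)) (ne_of_gt ?_)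
  have h : (1 : ℝ) < m + k₁ + k₂ := by exact_mod_cast (by omega : 1 < m + k₁ + k₂)
  linarith

theorem eq_one_div_sqrt_two_iff {r : ℝ} (hr : 0 < r) : r = 1 / √2 ↔ 2 * r ^ 2 = 1 := by
  rw [← Real.sqrt_one, ← Real.sqrt_div zero_le_one, eq_comm, Real.sqrt_eq_iff_eq_sq (by norm_num)
    hr.le]
  rw [Real.sqrt_one]
  constructor <;> intro h <;> linarith

end SphereMaps

theorem theorem3 (m n₁ n₂ k₁ k₂ : ℕ) (hm : 1 ≤ m)
    (r₁ r₂ : ℝ) (hr₁ : 0 < r₁) (hr₂ : 0 < r₂) (hr : r₁ ^ 2 + r₂ ^ 2 = 1)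
    (F₁ : Euc m → Euc n₁) (F₂ : Euc m → Euc n₂)
    (hF₁ : IsForm k₁ F₁) (hF₂ : IsForm k₂ F₂)
    (hΔ₁ : InnerProductSpace.HarmonicOnNhd F₁ Set.univ)
    (hΔ₂ : InnerProductSpace.HarmonicOnNhd F₂ Set.univ)
    (φ₁ : Sph (Euc m) 1 → Sph (Euc n₁) r₁) (φ₂ : Sph (Euc m) 1 → Sph (Euc n₂) r₂)
    (hφ₁ : ∀ x : Sph (Euc m) 1, (φ₁ x : Euc n₁) = F₁ x)
    (hφ₂ : ∀ x : Sph (Euc m) 1, (φ₂ x : Euc n₂) = F₂ x)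
    (φ : Sph (Euc m) 1 → Sph (EucProd n₁ n₂) 1)
    (hφ : ∀ x, φ x = prodIncl hr (φ₁ x, φ₂ x)) :
    (IsProperBiharmonic m (n₁ + n₂ + 1) φ ↔
      (r₁ = 1 / √2 ∧ r₂ = 1 / √2) ∧ k₁ ≠ k₂) ∧
    ∀ x : Sph (Euc m) 1,
      bitension m (n₁ + n₂ + 1) φ x =
        ((2 * r₁ ^ 2 - 1) * ((k₁ : ℝ) - k₂) ^ 2 * ((m : ℝ) + k₁ + k₂ - 1) ^ 2) •
          WithLp.toLp 2 ((r₁ ^ 2 - 1) • (φ₁ x : Euc n₁), r₁ ^ 2 • (φ₂ x : Euc n₂)) := by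
  have h₁ := hF₁.isSphericalForm hΔ₁ hφ₁
  have h₂ := hF₂.isSphericalForm hΔ₂ hφ₂
  have hφF (x) : (φ x : EucProd n₁ n₂) = WithLp.toLp 2 (F₁ x, F₂ x) := by
    rw [hφ, ← hφ₁, ← hφ₂]
    rfl
  have hτ := tension_eq (m := m) hr h₁ h₂ hφF
  have hτ₂ := bitension_eq (m := m) (n := n₁ + n₂ + 1) hr h₁ h₂ hφF
  have hsmooth : ContMDiff (𝓡 m) (𝓡 (n₁ + n₂ + 1)) ∞ φ := by
    have h : ContMDiff (𝓡 m) 𝓘(ℝ, EucProd n₁ n₂) ∞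
        (fun x : Sph (Euc m) 1 => WithLp.toLp 2 (F₁ x, F₂ x)) :=
      (contDiff_toLp_prodMk h₁.contDiff h₂.contDiff).contMDiff.comp contMDiff_coe_sphere
    have hmem (x : Sph (Euc m) 1) :
        WithLp.toLp 2 (F₁ x, F₂ x) ∈ Metric.sphere (0 : EucProd n₁ n₂) 1 := by
      rw [← hφF]; exact (φ x).2
    have heq : φ = Set.codRestrict _ _ hmem := funext fun x => Subtype.ext (hφF x)
    rw [heq]
    exact h.codRestrict_sphere hmem
  have hF₂_ne (x : Sph (Euc m) 1) : F₂ x ≠ 0 := norm_ne_zero_iff.1 (by rw [h₂.norm]; exact hr₂.ne')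
  have hr₁' : r₁ ^ 2 ≠ 0 := pow_ne_zero 2 hr₁.ne'
  let x₀ : Sph (Euc m) 1 := ⟨EuclideanSpace.single 0 1, by simp⟩
  refine ⟨⟨?_, ?_⟩, fun x => ?_⟩
  · rintro ⟨⟨-, hb⟩, hn⟩
    -- A zero gap would make φ harmonic.
    have hc : eigGap m k₁ k₂ ≠ 0 := fun hc => hn ⟨hsmooth, fun x => by rw [hτ, hc]; simp⟩
    -- One point and the second component suffice, as |F₂| = r₂ > 0 there.
    have h0 : ((2 * r₁ ^ 2 - 1) * eigGap m k₁ k₂ ^ 2) • r₁ ^ 2 • F₂ x₀ = 0 :=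
      congrArg (fun z : EucProd n₁ n₂ => z.snd) ((hτ₂ x₀).symm.trans (hb x₀))
    simp only [smul_eq_zero, mul_eq_zero, hF₂_ne, hr₁',
      pow_eq_zero_iff two_ne_zero, hc, or_false] at h0
    refine ⟨⟨(eq_one_div_sqrt_two_iff hr₁).2 (by linarith),
      (eq_one_div_sqrt_two_iff hr₂).2 (by linarith)⟩, fun hk => hc ?_⟩
    rw [hk, eigGap, sub_self, zero_mul]
  · rintro ⟨⟨hr, -⟩, hk⟩
    have hr' := (eq_one_div_sqrt_two_iff hr₁).1 hr
    refine ⟨⟨hsmooth, fun x => by rw [hτ₂, hr']; simp⟩, fun hn => ?_⟩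
    have h0 : (eigGap m k₁ k₂ * r₁ ^ 2) • F₂ x₀ = 0 :=
      congrArg (fun z : EucProd n₁ n₂ => z.snd) ((hτ x₀).symm.trans (hn.2 x₀))
    simp only [smul_eq_zero, mul_eq_zero, hF₂_ne, hr₁', eigGap_ne_zero hm hk,
      or_false] at h0
  · rw [hτ₂, hφ₁, hφ₂, eigGap, mul_pow, mul_assoc (2 * r₁ ^ 2 - 1)]
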